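/- **Setting.** Ground users and terrestrial base stations (TBSs) lie in the plane; aerial base stations (ABSs) hover at height $h>0$ above it. The typical user is at the origin. With $P_L(x)=\frac{1}{1+a\exp(-b\frac{180}{\pi}\tan^{-1}(\frac hx-a))}$ ($a,b>0$) and $P_N=1-P_L$, the horizontal locations of the LoS ABSs, the horizontal locations of the NLoS ABSs, and the locations of the TBSs form independent Poisson processes on $\mathbb R^2$ with intensities $\lambda_AP_L(|x|)$, $\lambda_AP_N(|x|)$ and $\lambda_T$ ($\lambda_A,\lambda_T>0$). An ABS at horizontal distance $x$ has distance $\sqrt{x^2+h^2}$ from the typical user. Each LoS (NLoS) ABS $i$, at distance $R_{L,i}$ ($R_{N,i}$), carries a fading gain $H_{L,i}\sim\Gamma(m_L,1/m_L)$ ($H_{N,i}\sim\Gamma(m_N,1/m_N)$), with integers $m_L,m_N\ge1$ (shape, scale); all gains are independent of each other and of all locations. Let $P_A,P_T,G_M,C_L,C_N,C_T,\alpha_L,\alpha_N,\alpha_T,R_B,\sigma_A^2>0$, $a_m>a_n>0$, $a_m+a_n=1$, $R_f\ge h$. Let $R_{L,0},R_{N,0},R_{T,0}$ be the distances from the typical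 user to the nearest LoS ABS, NLoS ABS and TBS, and let $H_{L,0}$ be the gain of the nearest LoS ABS. Let $B_L$ be the event that the typical user is associated with a LoS ABS, i.e. that $a_nP_AC_LR_{L,0}^{-\alpha_L}$ is at least $a_nP_AC_NR_{N,0}^{-\alpha_N}$ and at least $G_MP_TC_TR_{T,0}^{-\alpha_T}\mathbf 1\{R_{T,0}\le R_B\}$. Put $I_A=I_L+I_N\in[0,\infty]$, where $I_L=\sum P_AC_LR_{L,i}^{-\alpha_L}H_{L,i}$ is taken over all LoS ABSs except the nearest one and $I_N=\sum P_AC_NR_{N,i}^{-\alpha_N}H_{N,i}$ over all NLoS ABSs. The SINR of the typical user as far user ($R_{L,0}>R_f$) is $$\gamma=\frac{a_mP_AC_LR_{L,0}^{-\alpha_L}H_{L,0}}{a_nP_AC_LR_{L,0}^{-\alpha_L}H_{L,0}+I_L+I_N+\sigma_A^2}.$$ For a target $\epsilon_t>0$ let $P_{cov,far|LoS}(r)=\mathbb P(\gamma>\epsilon_t\mid B_L,\,R_{L,0}=r)$, and let $L_{I_A}(s)=\mathbb E[e^{-sI_A}\mid B_L,\,R_{L,0}=r]$ be the Laplace transform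 of the interference (regular conditional distributions; $e^{-s\infty}=0$). **Proposition.** Put $b_L=m_L(m_L!)^{-1/m_L}$ and, when $a_m\ne a_n\epsilon_t$, $\epsilon_t^f=\frac{\epsilon_t}{a_m-a_n\epsilon_t}$. For $c>0$ let $$S_c(r)=\sum_{k=1}^{m_L}(-1)^{k+1}\binom{m_L}{k}e^{-kc\frac{\epsilon_t^fr^{\alpha_L}\sigma_A^2}{P_AC_L}}\,L_{I_A}\!\left(kc\frac{\epsilon_t^fr^{\alpha_L}}{P_AC_L}\right).$$ 1. If $a_m-a_n\epsilon_t>0$, then $P_{cov,far|LoS}(r)\approx S_{b_L}(r)$ for almost every $r>R_f$ with respect to the law of $R_{L,0}$ given $B_L$, in the following sense: $$S_{m_L}(r)\le P_{cov,far|LoS}(r)\le S_{b_L}(r),\qquad |P_{cov,far|LoS}(r)-S_{b_L}(r)|\le\delta_{m_L},$$ where $\delta_m=\sup_{\tau\ge0}\bigl|F_m(\tau)-(1-e^{-m(m!)^{-1/m}\tau})^m\bigr|$ and $F_m$ is the distribution function of $\Gamma(m,1/m)$; and $P_{cov,far|LoS}(r)=S_{b_L}(r)$ if $m_L=1$. 2.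 If $a_m-a_n\epsilon_t\le0$, then $P_{cov,far|LoS}(r)=0$ for almost every $r>R_f$ with respect to that law. -/

import Mathlib

open MeasureTheory ProbabilityTheory
open scoped ENNReal

noncomputable section

namespace UAVNoma

/-- The horizontal plane; the typical user sits at the origin. -/
abbrev Plane : Type := EuclideanSpace ℝ (Fin 2)

/-- The random points `X 0, X 1, …` enumerate a Poisson point process with (infinite) intensity
measure `lam`: the number of points in a measurable set of finite intensity is Poisson distributed,
and the numbers of points in pairwise disjoint measurable sets are independent. -/
def IsPoissonProcess {Ω : Type*} [MeasurableSpace Ω] (μ : Measure Ω)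
    (X : ℕ → Ω → Plane) (lam : Measure Plane) : Prop :=
  (∀ i, Measurable (X i)) ∧
  (∀ B : Set Plane, MeasurableSet B → lam B ≠ ∞ → ∀ k : ℕ,
    μ {ω | {i | X i ω ∈ B}.encard = (k : ℕ∞)} =
      ENNReal.ofReal (Real.exp (-lam.real B) * lam.real B ^ k / (k.factorial : ℝ))) ∧
  (∀ (n : ℕ) (B : Fin n → Set Plane), (∀ j, MeasurableSet (B j)) →
    Pairwise (fun j l => Disjoint (B j) (B l)) →
    iIndepFun (fun (j : Fin n) (ω : Ω) => {i | X i ω ∈ B j}.encard) μ)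

/-- The deterministic parameters of the two-tier network. -/
structure Params where
  /-- densities of aerial (ABS) and terrestrial (TBS) base stations -/
  lamA : ℝ
  lamT : ℝ
  /-- common altitude of the ABSs -/
  h : ℝ
  /-- S-curve parameters of the line-of-sight probability -/
  a : ℝ
  b : ℝ
  /-- mmWave line-of-sight radius -/
  RB : ℝ
  /-- distance between the fixed user and the serving ABS -/
  Rf : ℝ
  /-- path loss exponents -/
  alphaL : ℝ
  alphaN : ℝ
  alphaT : ℝ
  /-- additive losses -/
  CL : ℝ
  CN : ℝ
  CT : ℝ
  /-- Nakagami fading parameters of the ABS links -/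
  mL : ℕ
  mN : ℕ
  /-- transmit powers, main-lobe gain of the TBSs, noise power of the ABS tier -/
  PA : ℝ
  PT : ℝ
  GM : ℝ
  sigma2 : ℝ
  /-- NOMA power allocation factors of the far and of the near user -/
  am : ℝ
  an : ℝ
  lamA_pos : 0 < lamA
  lamT_pos : 0 < lamT
  h_pos : 0 < h
  a_pos : 0 < a
  b_pos : 0 < b
  RB_pos : 0 < RB
  h_le_Rf : h ≤ Rf
  alphaL_pos : 0 < alphaL
  alphaN_pos : 0 < alphaN
  alphaT_pos : 0 < alphaT
  CL_pos : 0 < CL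
  CN_pos : 0 < CN
  CT_pos : 0 < CT
  mL_pos : 0 < mL
  mN_pos : 0 < mN
  PA_pos : 0 < PA
  PT_pos : 0 < PT
  GM_pos : 0 < GM
  sigma2_pos : 0 < sigma2
  an_pos : 0 < an
  an_lt_am : an < am
  am_add_an : am + an = 1

namespace Params

/-- Line-of-sight probability of a link of horizontal length `x`. -/
def probL (p : Params) (x : ℝ) : ℝ :=
  1 / (1 + p.a * Real.exp (-p.b * (180 / Real.pi) * Real.arctan (p.h / x - p.a)))

/-- Non-line-of-sight probability of a link of horizontal length `x`. -/
def probN (p : Params) (x : ℝ) : ℝ := 1 - p.probL x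

/-- Intensity measures on the plane of the LoS ABSs, of the NLoS ABSs and of the TBSs. -/
def intensityL (p : Params) : Measure Plane :=
  volume.withDensity fun x => ENNReal.ofReal (p.lamA * p.probL ‖x‖)

def intensityN (p : Params) : Measure Plane :=
  volume.withDensity fun x => ENNReal.ofReal (p.lamA * p.probN ‖x‖)

def intensityT (p : Params) : Measure Plane :=
  volume.withDensity fun _ => ENNReal.ofReal p.lamT

def etaL (p : Params) : ℝ := p.an * p.PA * p.CL
def etaN (p : Params) : ℝ := p.an * p.PA * p.CN
def etaT (p : Params) : ℝ := p.GM * p.PT * p.CT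

/-- `ε_t^f = ε_t / (a_m - a_n ε_t)`. -/
def epsFar (p : Params) (eps : ℝ) : ℝ := eps / (p.am - p.an * eps)

end Params

/-- A random realisation of the network on the probability space `(Ω, μ)`: the LoS ABSs, the NLoS
ABSs and the TBSs form independent Poisson processes, and the `i`-th LoS (NLoS) ABS carries the
fading gain `HL i` (`HN i`). All the fading gains are independent of each other and of all the
locations, and they are Gamma distributed with shape `m` and scale `1 / m` (that is, rate `m`). -/
structure Network (p : Params) {Ω : Type*} [MeasurableSpace Ω] (μ : Measure Ω) where
  XL : ℕ → Ω → Plane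
  XN : ℕ → Ω → Plane
  XT : ℕ → Ω → Plane
  HL : ℕ → Ω → ℝ
  HN : ℕ → Ω → ℝ
  poissonL : IsPoissonProcess μ XL p.intensityL
  poissonN : IsPoissonProcess μ XN p.intensityN
  poissonT : IsPoissonProcess μ XT p.intensityT
  measurable_HL : ∀ i, Measurable (HL i)
  measurable_HN : ∀ i, Measurable (HN i)
  law_HL : ∀ i, μ.map (HL i) = gammaMeasure p.mL p.mL
  law_HN : ∀ i, μ.map (HN i) = gammaMeasure p.mN p.mN
  indep_HL : iIndepFun HL μ
  indep_HN : iIndepFun HN μ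
  indep : iIndep
    ![MeasurableSpace.comap (fun ω i => XL i ω) inferInstance,
      MeasurableSpace.comap (fun ω i => XN i ω) inferInstance,
      MeasurableSpace.comap (fun ω i => XT i ω) inferInstance,
      MeasurableSpace.comap (fun ω i => HL i ω) inferInstance,
      MeasurableSpace.comap (fun ω i => HN i ω) inferInstance] μ

namespace Network

variable {p : Params} {Ω : Type*} [MeasurableSpace Ω] {μ : Measure Ω}

/-- Distance between the typical user and the `i`-th LoS ABS, NLoS ABS. -/
def distL (N : Network p μ) (i : ℕ) (ω : Ω) : ℝ := Real.sqrt (‖N.XL i ω‖ ^ 2 + p.h ^ 2)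
def distN (N : Network p μ) (i : ℕ) (ω : Ω) : ℝ := Real.sqrt (‖N.XN i ω‖ ^ 2 + p.h ^ 2)

/-- Minimum distances `R_{L,0}`, `R_{N,0}`, `R_{T,0}` between the typical user and the LoS ABSs,
the NLoS ABSs and the TBSs. -/
def RL0 (N : Network p μ) (ω : Ω) : ℝ := ⨅ i, N.distL i ω
def RN0 (N : Network p μ) (ω : Ω) : ℝ := ⨅ i, N.distN i ω
def RT0 (N : Network p μ) (ω : Ω) : ℝ := ⨅ i, ‖N.XT i ω‖

/-- Index of the nearest LoS ABS (almost surely there is exactly one). -/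
def nearest (N : Network p μ) (ω : Ω) : ℕ := sInf {i | ∀ j, N.distL i ω ≤ N.distL j ω}

/-- Long-term averaged received powers from the nearest LoS ABS, NLoS ABS and TBS. -/
def powerL (N : Network p μ) (ω : Ω) : ℝ := p.etaL * N.RL0 ω ^ (-p.alphaL)
def powerN (N : Network p μ) (ω : Ω) : ℝ := p.etaN * N.RN0 ω ^ (-p.alphaN)
def powerT (N : Network p μ) (ω : Ω) : ℝ :=
  p.etaT * N.RT0 ω ^ (-p.alphaT) * (if N.RT0 ω ≤ p.RB then 1 else 0)

/-- The event that the typical user is associated with a LoS ABS: the nearest LoS ABS offers the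
maximum long-term averaged received power. -/
def assocL (N : Network p μ) : Set Ω :=
  {ω | N.powerN ω ≤ N.powerL ω ∧ N.powerT ω ≤ N.powerL ω}

/-- Interference from the LoS ABSs other than the serving one, from the NLoS ABSs, and from all
ABSs, when the typical user is served by the nearest LoS ABS. -/
def interfL (N : Network p μ) (ω : Ω) : ℝ≥0∞ :=
  ∑' i, if i = N.nearest ω then 0
    else ENNReal.ofReal (p.PA * p.CL * N.distL i ω ^ (-p.alphaL) * N.HL i ω)

def interfN (N : Network p μ) (ω : Ω) : ℝ≥0∞ :=
  ∑' i, ENNReal.ofReal (p.PA * p.CN * N.distN i ω ^ (-p.alphaN) * N.HN i ω)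

def interfA (N : Network p μ) (ω : Ω) : ℝ≥0∞ := N.interfL ω + N.interfN ω

/-- Power `P_A C_L R_{L,0}^{-α_L} H_{L,0}` received from the serving LoS ABS. -/
def signalL (N : Network p μ) (ω : Ω) : ℝ :=
  p.PA * p.CL * N.RL0 ω ^ (-p.alphaL) * N.HL (N.nearest ω) ω

/-- SINR at which the typical user, being the far user of a LoS ABS, decodes its own message. -/
def sinrFarL (N : Network p μ) (ω : Ω) : ℝ≥0∞ :=
  ENNReal.ofReal (p.am * N.signalL ω) /
    (ENNReal.ofReal (p.an * N.signalL ω) + N.interfL ω + N.interfN ω + ENNReal.ofReal p.sigma2)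

/-- Coverage probability: the conditional probability that the SINR exceeds `eps`, given that the
typical user is associated with a LoS ABS and that `R_{L,0} = r`. -/
def covFarL (N : Network p μ) [IsProbabilityMeasure μ] (eps r : ℝ) : ℝ :=
  (condDistrib N.sinrFarL N.RL0 μ[|N.assocL] r).real (Set.Ioi (ENNReal.ofReal eps))

/-- `exp (-s y)`, with value `0` at `y = ∞`. -/
def expNeg (s : ℝ) (y : ℝ≥0∞) : ℝ := if y = ∞ then 0 else Real.exp (-(s * y.toReal))

/-- Laplace transform at `s` of the interference from the ABSs, given that the typical user is
associated with a LoS ABS and that `R_{L,0} = r`. -/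
def laplaceA (N : Network p μ) [IsProbabilityMeasure μ] (r s : ℝ) : ℝ :=
  ∫ y, expNeg s y ∂(condDistrib N.interfA N.RL0 μ[|N.assocL] r)

/-- The alternating binomial sum with rate `c` in place of `b_L`. -/
def farSum (N : Network p μ) [IsProbabilityMeasure μ] (c eps r : ℝ) : ℝ :=
  ∑ k ∈ Finset.Icc 1 p.mL, (-1 : ℝ) ^ (k + 1) * (p.mL.choose k : ℝ) *
    Real.exp (-((k : ℝ) * c * (p.epsFar eps * r ^ p.alphaL * p.sigma2 / (p.PA * p.CL)))) *
    N.laplaceA r ((k : ℝ) * c * (p.epsFar eps * r ^ p.alphaL / (p.PA * p.CL)))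

end Network

/-- `b = m (m!)^(-1/m)`. -/
def alzerRate (m : ℕ) : ℝ := (m : ℝ) * (m.factorial : ℝ) ^ (-(1 / (m : ℝ)))

/-- Largest error over `τ ≥ 0` of the approximation `(1 - exp (-b τ)) ^ m` to the distribution
function at `τ` of the Gamma law of shape `m` and scale `1 / m`. -/
def alzerGap (m : ℕ) : ℝ :=
  sSup ((fun τ : ℝ => |(gammaMeasure m m).real (Set.Iic τ) -
    (1 - Real.exp (-(alzerRate m * τ))) ^ m|) '' Set.Ici 0)

end UAVNoma

end

noncomputable section

namespace UAVNoma

/-! Write `τ(y) = ε_t^f r^α_L (y + σ_A²) / (P_A C_L)`. Since the useful signal also appears in the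
denominator of the SINR, coverage at distance `r` against finite interference `y` requires `(a_m -
a_n ε_t) × signal` to exceed `ε_t (y + σ_A²)`. This is impossible if `a_m - a_n ε_t ≤ 0`; otherwise
it says that the serving gain exceeds `τ(y)`.

The serving gain is Gamma distributed and independent of association, serving distance and
interference (`measure_inter_HL_nearest`): on the event that the nearest index is `n`, these three
do not involve the `n`-th gain. Hence for almost every `r` the coverage probability is the mean of
`1 - F_m(τ(I_A))` under the conditional law of `I_A` (`covFarL_ae_eq`), infinite interference
contributing `0`.

It remains to use `(1 - e^{-bτ})^m ≤ F_m(τ) ≤ (1 - e^{-mτ})^m`. The right inequality compares a sum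
of exponential variables with their maximum (`erlangCdf_le_one_sub_exp_pow`); the left one is
Alzer's (`one_sub_exp_pow_le_erlangCdf`). Because `τ` is affine in `y`, the binomial theorem turns
the mean of `1 - (1 - e^{-cτ(I_A)})^m` into `S_c(r)` (`farSum_eq_integral`). -/

/-! ### Two-sided exponential bounds for the Erlang distribution function. -/

/-- Distribution function on `[0, ∞)` of the Gamma law with integer shape `m` and rate `1`. -/
def erlangCdf (m : ℕ) (x : ℝ) : ℝ :=
  1 - Real.exp (-x) * ∑ k ∈ Finset.range m, x ^ k / (k.factorial : ℝ)

lemma erlangCdf_succ (m : ℕ) (x : ℝ) :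
    erlangCdf (m + 1) x = erlangCdf m x - Real.exp (-x) * (x ^ m / (m.factorial : ℝ)) := by
  simp only [erlangCdf, Finset.sum_range_succ]
  ring

lemma erlangCdf_succ_zero (m : ℕ) : erlangCdf (m + 1) 0 = 0 := by
  simp [erlangCdf, Finset.sum_range_succ']

/-- The derivative telescopes: differentiating the term added by `erlangCdf_succ` cancels the
previous density and leaves the next one. -/
lemma hasDerivAt_erlangCdf_succ (m : ℕ) (x : ℝ) :
    HasDerivAt (erlangCdf (m + 1)) (Real.exp (-x) * (x ^ m / (m.factorial : ℝ))) x := by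
  have hexp : HasDerivAt (fun y : ℝ => Real.exp (-y)) (-Real.exp (-x)) x := by
    simpa using (hasDerivAt_neg x).exp
  induction m with
  | zero =>
    have : erlangCdf (0 + 1) = fun y => 1 - Real.exp (-y) := by
      funext y; simp [erlangCdf]
    rw [this]
    simpa using hexp.const_sub 1
  | succ m ih =>
    have : erlangCdf (m + 1 + 1) = fun y => erlangCdf (m + 1) y -
        Real.exp (-y) * (y ^ (m + 1) / ((m + 1).factorial : ℝ)) :=
      funext (erlangCdf_succ (m + 1))
    rw [this]
    have hpow : HasDerivAt (fun y : ℝ => y ^ (m + 1) / ((m + 1).factorial : ℝ))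
        (x ^ m / (m.factorial : ℝ)) x := by
      refine ((hasDerivAt_pow (m + 1) x).div_const ((m + 1).factorial : ℝ)).congr_deriv ?_
      rw [Nat.factorial_succ]
      push_cast
      field_simp
    refine (ih.sub (hexp.mul hpow)).congr_deriv ?_
    ring

lemma tendsto_erlangCdf (m : ℕ) :
    Filter.Tendsto (erlangCdf m) Filter.atTop (nhds 1) := by
  have h : Filter.Tendsto (fun x : ℝ => ∑ k ∈ Finset.range m,
      (x ^ k * Real.exp (-x)) / (k.factorial : ℝ)) Filter.atTop
      (nhds (∑ k ∈ Finset.range m, 0 / (k.factorial : ℝ))) :=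
    tendsto_finsetSum _ fun k _ =>
      (Real.tendsto_pow_mul_exp_neg_atTop_nhds_zero k).div_const _
  have h' := h.const_sub 1
  simp only [zero_div, Finset.sum_const_zero, sub_zero] at h'
  refine h'.congr fun x => ?_
  simp only [erlangCdf, Finset.mul_sum]
  congr 1
  exact Finset.sum_congr rfl fun k _ => by ring

/-- Drop the factor `e^{-y} ≤ 1` from the density and integrate. -/
lemma erlangCdf_le_pow_div_factorial (m : ℕ) {x : ℝ} (hx : 0 ≤ x) :
    erlangCdf (m + 1) x ≤ x ^ (m + 1) / ((m + 1).factorial : ℝ) := by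
  have hder (y : ℝ) : HasDerivAt
      (fun y : ℝ => y ^ (m + 1) / ((m + 1).factorial : ℝ) - erlangCdf (m + 1) y)
      (y ^ m / (m.factorial : ℝ) - Real.exp (-y) * (y ^ m / (m.factorial : ℝ))) y := by
    refine HasDerivAt.sub ?_ (hasDerivAt_erlangCdf_succ m y)
    refine ((hasDerivAt_pow (m + 1) y).div_const ((m + 1).factorial : ℝ)).congr_deriv ?_
    rw [Nat.factorial_succ]
    push_cast
    field_simp
  have hmono : MonotoneOn
      (fun y : ℝ => y ^ (m + 1) / ((m + 1).factorial : ℝ) - erlangCdf (m + 1) y)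
      (Set.Ici 0) := by
    refine monotoneOn_of_deriv_nonneg (convex_Ici 0)
      (fun y _ => (hder y).continuousAt.continuousWithinAt)
      (fun y _ => (hder y).differentiableAt.differentiableWithinAt) fun y hy => ?_
    rw [interior_Ici, Set.mem_Ioi] at hy
    rw [(hder y).deriv]
    have h1 : Real.exp (-y) ≤ 1 := Real.exp_le_one_iff.2 (by linarith)
    have h2 : 0 ≤ y ^ m / (m.factorial : ℝ) := by positivity
    nlinarith
  have := hmono Set.self_mem_Ici (Set.mem_Ici.2 hx) hx
  simp only [erlangCdf_succ_zero] at this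
  simp at this
  linarith

/-- A sum of `m` exponential variables is at least their maximum. -/
lemma erlangCdf_le_one_sub_exp_pow (m : ℕ) {x : ℝ} (hx : 0 ≤ x) :
    erlangCdf (m + 1) x ≤ (1 - Real.exp (-x)) ^ (m + 1) := by
  have hexp : Real.exp (-x) ≤ 1 := Real.exp_le_one_iff.2 (by linarith)
  induction m with
  | zero => simp [erlangCdf]
  | succ m ih =>
    rw [erlangCdf_succ, pow_succ (1 - Real.exp (-x))]
    -- The subtracted term is at least `e^{-x} * erlangCdf (m + 1) x`, so one more stage multiplies
    -- the distribution function by at most `1 - e^{-x}`.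
    have h1 := erlangCdf_le_pow_div_factorial m hx
    have h2 := Real.exp_pos (-x)
    have h3 := mul_le_mul_of_nonneg_left h1 h2.le
    have h4 := mul_le_mul_of_nonneg_right ih (sub_nonneg.2 hexp)
    linarith

/-- Laplace transform of the uniform law on `[κ - 1, κ]`. -/
lemma integral_exp_sub_mul (κ : ℝ) {y : ℝ} (hy : y ≠ 0) :
    ∫ t in (0 : ℝ)..1, Real.exp ((κ - t) * y) =
      Real.exp (κ * y) * (1 - Real.exp (-y)) / y := by
  have hder (t : ℝ) : HasDerivAt (fun t : ℝ => -(Real.exp ((κ - t) * y) / y))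
      (Real.exp ((κ - t) * y)) t := by
    have h := ((((hasDerivAt_id t).const_sub κ).mul_const y).exp.div_const y).neg
    refine h.congr_deriv ?_
    simp only [id]
    field_simp
  rw [intervalIntegral.integral_eq_sub_of_hasDerivAt (fun t _ => hder t)
    (Continuous.intervalIntegrable (by fun_prop) _ _)]
  rw [show (κ - 1) * y = κ * y + -y by ring, Real.exp_add, sub_zero]
  ring

/-- By convexity of `exp`, the chord slope from `0` of `y ↦ ∫ e^{(κ - t) y}` is nondecreasing. As
the value at `0` is `1`, this function crosses the level `1` at most once on `(0, ∞)`, from below.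
-/
lemma integral_exp_sub_one_le (κ : ℝ) {u y : ℝ} (hu : 0 < u) (huy : u ≤ y) :
    (∫ t in (0 : ℝ)..1, Real.exp ((κ - t) * u)) - 1 ≤
      u / y * ((∫ t in (0 : ℝ)..1, Real.exp ((κ - t) * y)) - 1) := by
  have hy : 0 < y := hu.trans_le huy
  have hle : u / y ≤ 1 := (div_le_one hy).2 huy
  have h0 : 0 ≤ u / y := by positivity
  have hpt (t : ℝ) : Real.exp ((κ - t) * u) ≤
      u / y * Real.exp ((κ - t) * y) + (1 - u / y) := by
    have h := convexOn_exp.2 (Set.mem_univ ((κ - t) * y)) (Set.mem_univ (0 : ℝ)) h0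
      (sub_nonneg.2 hle) (by ring)
    simp only [smul_eq_mul, mul_zero, add_zero, Real.exp_zero, mul_one] at h
    have hu' : u / y * ((κ - t) * y) = (κ - t) * u := by field_simp
    rwa [hu'] at h
  have hint (z : ℝ) : IntervalIntegrable (fun t : ℝ => Real.exp ((κ - t) * z)) volume 0 1 :=
    Continuous.intervalIntegrable (by fun_prop) _ _
  have h := intervalIntegral.integral_mono_on zero_le_one (hint u)
    (((hint y).const_mul (u / y)).add intervalIntegrable_const) fun t _ => hpt t
  rw [intervalIntegral.integral_add ((hint y).const_mul _) intervalIntegrable_const,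
    intervalIntegral.integral_const_mul] at h
  simp at h
  linarith

/-- Alzer's inequality for the incomplete Gamma function of integer order. -/
lemma one_sub_exp_pow_le_erlangCdf (m : ℕ) {β x : ℝ} (hβ : 0 < β)
    (hβm : β ^ (m + 1) * ((m + 1).factorial : ℝ) = 1) (hx : 0 ≤ x) :
    (1 - Real.exp (-(β * x))) ^ (m + 1) ≤ erlangCdf (m + 1) x := by
  rcases hx.eq_or_lt with rfl | hx
  · simp [erlangCdf_succ_zero]
  -- Shape `1` is an equality, and is set apart because `κ` divides by `m`.
  rcases Nat.eq_zero_or_pos m with rfl | hm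
  · have : β = 1 := by simpa using hβm
    simp [this, erlangCdf]
  -- Chosen so that `m κ β + β = 1`: then `e^{-mκβy} e^{-βy} = e^{-y}`, and with the normalisation
  -- of `β` the derivative of `G` is the Erlang density times `1 - Φ(βy)^m`.
  set κ : ℝ := (1 - β) / (β * m) with hκ
  set Φ : ℝ → ℝ := fun y => ∫ t in (0 : ℝ)..1, Real.exp ((κ - t) * y) with hΦ
  set G : ℝ → ℝ := fun y => erlangCdf (m + 1) y - (1 - Real.exp (-(β * y))) ^ (m + 1) with hG
  have hm0 : (m : ℝ) ≠ 0 := by positivity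
  have hder (y : ℝ) : HasDerivAt G (Real.exp (-y) * (y ^ m / (m.factorial : ℝ)) -
      (m + 1) * (1 - Real.exp (-(β * y))) ^ m * (β * Real.exp (-(β * y)))) y := by
    refine (hasDerivAt_erlangCdf_succ m y).sub ?_
    have h1 : HasDerivAt (fun y : ℝ => 1 - Real.exp (-(β * y)))
        (β * Real.exp (-(β * y))) y := by
      refine ((((hasDerivAt_id y).const_mul β).neg.exp).const_sub 1).congr_deriv ?_
      simp only [id, Pi.neg_apply]
      ring
    refine (h1.pow (m + 1)).congr_deriv ?_
    simp
  have hderiv (y : ℝ) (hy : 0 < y) : deriv G y =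
      Real.exp (-y) * (y ^ m / (m.factorial : ℝ)) * (1 - Φ (β * y) ^ m) := by
    have hβy : β * y ≠ 0 := by positivity
    have hΦy : 1 - Real.exp (-(β * y)) = β * y * Real.exp (-(κ * (β * y))) * Φ (β * y) := by
      simp only [hΦ]
      rw [integral_exp_sub_mul κ hβy, Real.exp_neg (κ * (β * y))]
      field_simp
    rw [(hder y).deriv, mul_sub, mul_one]
    congr 1
    rw [hΦy, mul_pow, mul_pow, ← Real.exp_nat_mul]
    have hexp : Real.exp (m * -(κ * (β * y))) * Real.exp (-(β * y)) = Real.exp (-y) := by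
      rw [← Real.exp_add]
      congr 1
      rw [hκ]
      field_simp
      ring
    rw [← hexp]
    have hf : (m + 1 : ℝ) * (m.factorial : ℝ) * β ^ (m + 1) = 1 := by
      rw [Nat.factorial_succ] at hβm
      push_cast at hβm
      linarith
    have hf' : (m + 1 : ℝ) * β ^ (m + 1) = 1 / (m.factorial : ℝ) := by
      field_simp
      linarith
    calc _ = ((m + 1 : ℝ) * β ^ (m + 1)) * (y ^ m * Real.exp (m * -(κ * (β * y))) *
          Φ (β * y) ^ m * Real.exp (-(β * y))) := by ring
      _ = _ := by rw [hf']; ring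
  have hΦ0 (y : ℝ) : 0 ≤ Φ y :=
    intervalIntegral.integral_nonneg zero_le_one fun t _ => (Real.exp_pos _).le
  have hcont : Continuous G := continuous_iff_continuousAt.2 fun y => (hder y).continuousAt
  have hdiff : Differentiable ℝ G := fun y => (hder y).differentiableAt
  suffices 0 ≤ G x by simpa [hG] using this
  -- `G` vanishes at `0` and at infinity, and its derivative changes sign at most once, from `+` to
  -- `-`. So `G` increases from `0` up to `x`, or decreases from `x` on to its limit `0`.
  rcases le_or_gt (Φ (β * x)) 1 with h | h
  · have hmono : MonotoneOn G (Set.Icc 0 x) := by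
      refine monotoneOn_of_deriv_nonneg (convex_Icc 0 x) hcont.continuousOn
        hdiff.differentiableOn fun y hy => ?_
      rw [interior_Icc, Set.mem_Ioo] at hy
      obtain ⟨hy0, hyx⟩ := hy
      rw [hderiv y hy0]
      have h1 := integral_exp_sub_one_le κ (mul_pos hβ hy0)
        (mul_le_mul_of_nonneg_left hyx.le hβ.le)
      have h2 : β * y / (β * x) * (Φ (β * x) - 1) ≤ 0 :=
        mul_nonpos_of_nonneg_of_nonpos (by positivity) (by linarith)
      have h3 : Φ (β * y) ≤ 1 := by
        simp only [hΦ] at h2 ⊢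
        linarith
      have h4 : Φ (β * y) ^ m ≤ 1 := pow_le_one₀ (hΦ0 _) h3
      have : 0 ≤ 1 - Φ (β * y) ^ m := by linarith
      positivity
    have := hmono (Set.left_mem_Icc.2 hx.le) (Set.right_mem_Icc.2 hx.le) hx.le
    simpa [hG, erlangCdf_succ_zero] using this
  · have hanti : AntitoneOn G (Set.Ici x) := by
      refine antitoneOn_of_deriv_nonpos (convex_Ici x) hcont.continuousOn
        hdiff.differentiableOn fun y hy => ?_
      rw [interior_Ici, Set.mem_Ioi] at hy
      have hy0 : 0 < y := hx.trans hy
      rw [hderiv y hy0]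
      have h1 := integral_exp_sub_one_le κ (mul_pos hβ hx)
        (mul_le_mul_of_nonneg_left hy.le hβ.le)
      have h3 : 1 ≤ Φ (β * y) := by
        by_contra hlt
        have h2 : β * x / (β * y) * (Φ (β * y) - 1) ≤ 0 :=
          mul_nonpos_of_nonneg_of_nonpos (by positivity) (by linarith)
        simp only [hΦ] at h2 h
        linarith
      exact mul_nonpos_of_nonneg_of_nonpos (by positivity)
        (sub_nonpos.2 (one_le_pow₀ h3))
    have hlim : Filter.Tendsto G Filter.atTop (nhds (1 - (1 - 0) ^ (m + 1))) := by
      refine (tendsto_erlangCdf (m + 1)).sub ((Filter.Tendsto.const_sub 1 ?_).pow (m + 1))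
      exact Real.tendsto_exp_neg_atTop_nhds_zero.comp (Filter.tendsto_id.const_mul_atTop hβ)
    simp only [sub_zero, one_pow, sub_self] at hlim
    refine le_of_tendsto hlim ?_
    filter_upwards [Filter.eventually_ge_atTop x] with y hy
    exact hanti Set.self_mem_Ici (Set.mem_Ici.2 hy) hy

/-! ### Transfer of the bounds to the Gamma law of shape `m` and rate `m`. -/

lemma gammaMeasure_real_Iic (m : ℕ) {r x : ℝ} (hr : 0 < r) (hx : 0 ≤ x) :
    (gammaMeasure ((m + 1 : ℕ) : ℝ) r).real (Set.Iic x) = erlangCdf (m + 1) (r * x) := by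
  have hm : (0 : ℝ) < ((m + 1 : ℕ) : ℝ) := by positivity
  have := isProbabilityMeasure_gammaMeasure hm hr
  rw [← cdf_eq_real, cdf_gammaMeasure_eq_integral hm hr]
  have h1 : ∫ y in Set.Iic x, gammaPDFReal ((m + 1 : ℕ) : ℝ) r y =
      ∫ y in Set.Icc 0 x, gammaPDFReal ((m + 1 : ℕ) : ℝ) r y := by
    refine setIntegral_eq_of_subset_of_forall_sdiff_eq_zero measurableSet_Iic
      (fun y hy => hy.2) fun y hy => ?_
    have : ¬ 0 ≤ y := fun h => hy.2 ⟨h, hy.1⟩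
    simp [gammaPDFReal, this]
  have h2 : ∫ y in Set.Icc 0 x, gammaPDFReal ((m + 1 : ℕ) : ℝ) r y =
      ∫ y in Set.Icc 0 x, r * (Real.exp (-(r * y)) * ((r * y) ^ m / (m.factorial : ℝ))) := by
    refine setIntegral_congr_fun measurableSet_Icc fun y hy => ?_
    simp only [gammaPDFReal, hy.1, if_true]
    push_cast
    rw [Real.Gamma_nat_eq_factorial, add_sub_cancel_right, Real.rpow_natCast,
      ← Nat.cast_succ, Real.rpow_natCast, mul_pow, pow_succ]
    ring
  have hder (y : ℝ) : HasDerivAt (fun y => erlangCdf (m + 1) (r * y))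
      (r * (Real.exp (-(r * y)) * ((r * y) ^ m / (m.factorial : ℝ)))) y := by
    refine ((hasDerivAt_erlangCdf_succ m (r * y)).comp y
      ((hasDerivAt_id y).const_mul r)).congr_deriv ?_
    ring
  rw [h1, h2, integral_Icc_eq_integral_Ioc, ← intervalIntegral.integral_of_le hx,
    intervalIntegral.integral_eq_sub_of_hasDerivAt (fun y _ => hder y)
      (Continuous.intervalIntegrable (by fun_prop) _ _)]
  simp [erlangCdf_succ_zero]

lemma alzerRate_pos {m : ℕ} (hm : 0 < m) : 0 < alzerRate m := by
  have := Nat.factorial_pos m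
  unfold alzerRate
  positivity

lemma gammaMeasure_real_Iic_le {m : ℕ} (hm : 0 < m) {x : ℝ} (hx : 0 ≤ x) :
    (gammaMeasure m m).real (Set.Iic x) ≤ (1 - Real.exp (-((m : ℝ) * x))) ^ m := by
  obtain ⟨n, rfl⟩ := Nat.exists_eq_succ_of_ne_zero hm.ne'
  rw [Nat.succ_eq_add_one, gammaMeasure_real_Iic n (by positivity) hx]
  exact erlangCdf_le_one_sub_exp_pow n (by positivity)

lemma le_gammaMeasure_real_Iic {m : ℕ} (hm : 0 < m) {x : ℝ} (hx : 0 ≤ x) :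
    (1 - Real.exp (-(alzerRate m * x))) ^ m ≤ (gammaMeasure m m).real (Set.Iic x) := by
  obtain ⟨n, rfl⟩ := Nat.exists_eq_succ_of_ne_zero hm.ne'
  have hf : (0 : ℝ) < ((n + 1).factorial : ℝ) := by positivity
  rw [Nat.succ_eq_add_one, gammaMeasure_real_Iic n (by positivity) hx]
  -- With `β = (m!)^{-1/m}` one has `β^m m! = 1`, and `alzerRate m * x = β * (m * x)`, the factor
  -- `m` being the rate.
  have h := one_sub_exp_pow_le_erlangCdf n
    (β := ((n + 1).factorial : ℝ) ^ (-(1 / ((n + 1 : ℕ) : ℝ))))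
    (x := ((n + 1 : ℕ) : ℝ) * x) (by positivity) ?_ (by positivity)
  · convert h using 5
    rw [alzerRate]
    ring
  · rw [← Real.rpow_natCast, ← Real.rpow_mul hf.le]
    have : -(1 / ((n + 1 : ℕ) : ℝ)) * ((n + 1 : ℕ) : ℝ) = -1 := by
      have : ((n + 1 : ℕ) : ℝ) ≠ 0 := by positivity
      field_simp
    rw [this, Real.rpow_neg_one, inv_mul_cancel₀ hf.ne']

lemma abs_sub_le_alzerGap {m : ℕ} (hm : 0 < m) {x : ℝ} (hx : 0 ≤ x) :
    |(gammaMeasure m m).real (Set.Iic x) - (1 - Real.exp (-(alzerRate m * x))) ^ m| ≤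
      alzerGap m := by
  have hm' : (0 : ℝ) < m := by positivity
  have := isProbabilityMeasure_gammaMeasure hm' hm'
  -- A real `sSup` is meaningful only for a set bounded above; here both compared quantities lie in
  -- `[0, 1]`.
  refine le_csSup ⟨1, ?_⟩ ⟨x, hx, rfl⟩
  rintro _ ⟨τ, hτ, rfl⟩
  have h0 : Real.exp (-(alzerRate m * τ)) ≤ 1 :=
    Real.exp_le_one_iff.2 (neg_nonpos.2 (mul_nonneg (alzerRate_pos hm).le hτ))
  have h1 : 0 ≤ (1 - Real.exp (-(alzerRate m * τ))) ^ m := pow_nonneg (by linarith) m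
  have h2 : (1 - Real.exp (-(alzerRate m * τ))) ^ m ≤ 1 :=
    pow_le_one₀ (by linarith) (by linarith [Real.exp_pos (-(alzerRate m * τ))])
  have h3 := le_gammaMeasure_real_Iic hm hτ
  have h4 : (gammaMeasure m m).real (Set.Iic τ) ≤ 1 := measureReal_le_one
  simp only
  rw [abs_le]
  constructor <;> linarith

lemma alzerGap_nonneg {m : ℕ} (hm : 0 < m) : 0 ≤ alzerGap m :=
  (abs_nonneg _).trans (abs_sub_le_alzerGap hm le_rfl)

/-! ### Measurability and independence tools. -/

lemma measurable_sInf_forall_le {S : Type*} {_ : MeasurableSpace S} {d : ℕ → S → ℝ}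
    (hd : ∀ i, Measurable (d i)) :
    Measurable fun s => sInf {i | ∀ j, d i s ≤ d j s} := by
  have hmin (i : ℕ) : MeasurableSet {s | ∀ j, d i s ≤ d j s} := by
    simp only [Set.ofPred_forall]
    exact MeasurableSet.iInter fun j => measurableSet_le (hd i) (hd j)
  refine measurable_to_countable' fun n => ?_
  -- The fibre over `n` is where `n` is the first minimiser; the fibre over `0` also contains the
  -- points without minimiser, since `sInf ∅ = 0` in `ℕ`.
  have hset : (fun s => sInf {i | ∀ j, d i s ≤ d j s}) ⁻¹' {n} =
      ({s | ∀ j, d n s ≤ d j s} ∩ ⋂ i : ℕ, ⋂ _ : i < n, {s | ∀ j, d i s ≤ d j s}ᶜ) ∪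
        ({_s | n = 0} ∩ ⋂ i : ℕ, {s | ∀ j, d i s ≤ d j s}ᶜ) := by
    ext s
    simp only [Set.mem_preimage, Set.mem_singleton_iff, Set.mem_union, Set.mem_inter_iff,
      Set.mem_iInter, Set.mem_compl_iff, Set.mem_ofPred_eq]
    rcases Set.eq_empty_or_nonempty {i | ∀ j, d i s ≤ d j s} with h | h
    · have h' (i : ℕ) : ¬ ∀ j, d i s ≤ d j s := fun hi =>
        Set.eq_empty_iff_forall_notMem.1 h i hi
      rw [h, Nat.sInf_empty]
      exact ⟨fun hn => Or.inr ⟨hn.symm, h'⟩, fun hn => hn.elim (fun hn => absurd hn.1 (h' n))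
        fun hn => hn.1.symm⟩
    · constructor
      · rintro rfl
        exact Or.inl ⟨Nat.sInf_mem h, fun i hi => Nat.notMem_of_lt_sInf hi⟩
      · rintro (hn | hn)
        · exact le_antisymm (Nat.sInf_le hn.1)
            (le_of_not_gt fun hlt => hn.2 _ hlt (Nat.sInf_mem h))
        · obtain ⟨i, hi⟩ := h
          exact absurd hi (hn.2 i)
  rw [hset]
  exact ((hmin n).inter (MeasurableSet.iInter fun i => MeasurableSet.iInter fun _ =>
    (hmin i).compl)).union ((MeasurableSet.const _).inter
      (MeasurableSet.iInter fun i => (hmin i).compl))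

lemma measurable_ennreal_tsum {S : Type*} {_ : MeasurableSpace S} {f : ℕ → S → ℝ≥0∞}
    (hf : ∀ i, Measurable (f i)) : Measurable fun s => ∑' i, f i s :=
  Measurable.tsum hf

/-- If `X` is independent of `(Y, Z)` and `Y` is independent of `Z`, then `(X, Y)` is independent
of `Z`. -/
lemma indepFun_prodMk_of_indepFun_prodMk {Ω α β γ : Type*} [MeasurableSpace Ω]
    [MeasurableSpace α] [MeasurableSpace β] [MeasurableSpace γ] {μ : Measure Ω}
    [IsFiniteMeasure μ] {X : Ω → α} {Y : Ω → β} {Z : Ω → γ} (hX : Measurable X)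
    (hY : Measurable Y) (hZ : Measurable Z) (h : IndepFun X (fun ω => (Y ω, Z ω)) μ)
    (h' : IndepFun Y Z μ) : IndepFun (fun ω => (X ω, Y ω)) Z μ := by
  have hXY : IndepFun X Y μ := h.comp measurable_id measurable_fst
  rw [indepFun_iff_map_prod_eq_prod_map_map hX.aemeasurable (by fun_prop)] at h hXY
  rw [indepFun_iff_map_prod_eq_prod_map_map hY.aemeasurable hZ.aemeasurable] at h'
  rw [indepFun_iff_map_prod_eq_prod_map_map (by fun_prop) hZ.aemeasurable, hXY]
  have hmap : μ.map (fun ω => ((X ω, Y ω), Z ω)) =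
      (μ.map fun ω => (X ω, (Y ω, Z ω))).map MeasurableEquiv.prodAssoc.symm := by
    rw [Measure.map_map (by fun_prop) (by fun_prop)]
    rfl
  rw [hmap, h, h', ← Measure.prodAssoc_prod, Measure.map_map (by fun_prop) (by fun_prop)]
  simp

namespace Network

/-! ### Measurability of the network functionals, relative to an arbitrary σ-algebra `m` so that it
can later be a generated one. -/

section Measurability

variable {p : Params} {Ω : Type*} {m : MeasurableSpace Ω} [mΩ : MeasurableSpace Ω]
  {μ : Measure Ω} (N : Network p μ)

lemma measurable_distL (hX : ∀ i, Measurable[m] (N.XL i)) (i : ℕ) :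
    Measurable[m] (N.distL i) :=
  (by fun_prop : Measurable fun x : Plane => Real.sqrt (‖x‖ ^ 2 + p.h ^ 2)).comp (hX i)

lemma measurable_distN (hX : ∀ i, Measurable[m] (N.XN i)) (i : ℕ) :
    Measurable[m] (N.distN i) :=
  (by fun_prop : Measurable fun x : Plane => Real.sqrt (‖x‖ ^ 2 + p.h ^ 2)).comp (hX i)

lemma measurable_RL0 (hX : ∀ i, Measurable[m] (N.XL i)) : Measurable[m] N.RL0 :=
  Measurable.iInf fun i => N.measurable_distL hX i

lemma measurable_RN0 (hX : ∀ i, Measurable[m] (N.XN i)) : Measurable[m] N.RN0 :=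
  Measurable.iInf fun i => N.measurable_distN hX i

lemma measurable_RT0 (hX : ∀ i, Measurable[m] (N.XT i)) : Measurable[m] N.RT0 :=
  Measurable.iInf fun i => measurable_norm.comp (hX i)

lemma measurable_nearest (hX : ∀ i, Measurable[m] (N.XL i)) : Measurable[m] N.nearest :=
  measurable_sInf_forall_le fun i => N.measurable_distL hX i

lemma measurableSet_assocL (hL : ∀ i, Measurable[m] (N.XL i))
    (hN : ∀ i, Measurable[m] (N.XN i)) (hT : ∀ i, Measurable[m] (N.XT i)) :
    MeasurableSet[m] N.assocL := by
  have h1 : Measurable[m] N.powerL := ((N.measurable_RL0 hL).pow_const _).const_mul _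
  have h2 : Measurable[m] N.powerN := ((N.measurable_RN0 hN).pow_const _).const_mul _
  have h3 : Measurable[m] N.powerT :=
    (((N.measurable_RT0 hT).pow_const _).const_mul _).mul
      (Measurable.ite (measurableSet_le (N.measurable_RT0 hT) measurable_const)
        measurable_const measurable_const)
  exact (measurableSet_le h2 h1).inter (measurableSet_le h3 h1)

/-- Interference from all ABSs other than the `n`-th LoS ABS. -/
def interfExcept (n : ℕ) (ω : Ω) : ℝ≥0∞ :=
  (∑' i, if i = n then 0
    else ENNReal.ofReal (p.PA * p.CL * N.distL i ω ^ (-p.alphaL) * N.HL i ω)) + N.interfN ω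

/-- The `n`-th LoS gain is left out of the assumptions: this is what makes the remaining
interference independent of it. -/
lemma measurable_interfExcept (hL : ∀ i, Measurable[m] (N.XL i))
    (hN : ∀ i, Measurable[m] (N.XN i)) (hHN : ∀ i, Measurable[m] (N.HN i)) (n : ℕ)
    (hHL : ∀ i, i ≠ n → Measurable[m] (N.HL i)) : Measurable[m] (N.interfExcept n) := by
  refine Measurable.add (measurable_ennreal_tsum fun i => ?_)
    (measurable_ennreal_tsum fun i => ?_)
  · split_ifs with h
    · exact measurable_const
    · exact ((((N.measurable_distL hL i).pow_const _).const_mul _).mul (hHL i h)).ennreal_ofReal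
  · exact ((((N.measurable_distN hN i).pow_const _).const_mul _).mul (hHN i)).ennreal_ofReal

lemma interfA_eq_interfExcept (ω : Ω) : N.interfA ω = N.interfExcept (N.nearest ω) ω := rfl

end Measurability

variable {p : Params} {Ω : Type*} [mΩ : MeasurableSpace Ω] {μ : Measure Ω}

variable (N : Network p μ)

lemma measurable_comp_nearest {β : Type*} [MeasurableSpace β] {f : ℕ → Ω → β}
    (hf : ∀ n, Measurable (f n)) : Measurable fun ω => f (N.nearest ω) ω := by
  have h : Measurable fun q : ℕ × Ω => f q.1 q.2 := measurable_from_prod_countable_right hf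
  exact h.comp ((N.measurable_nearest N.poissonL.1).prodMk measurable_id)

lemma measurable_interfA : Measurable N.interfA :=
  N.measurable_comp_nearest fun n => N.measurable_interfExcept N.poissonL.1 N.poissonN.1
    N.measurable_HN n fun i _ => N.measurable_HL i

/-! ### Independence of the serving gain from everything else. -/

/-- All sources of randomness except the gains of the LoS ABSs. -/
def config (ω : Ω) : (ℕ → Plane) × (ℕ → Plane) × (ℕ → Plane) × (ℕ → ℝ) :=
  (fun i => N.XL i ω, fun i => N.XN i ω, fun i => N.XT i ω, fun i => N.HN i ω)

lemma measurable_config : Measurable N.config :=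
  (measurable_pi_lambda _ N.poissonL.1).prodMk <| (measurable_pi_lambda _ N.poissonN.1).prodMk <|
    (measurable_pi_lambda _ N.poissonT.1).prodMk (measurable_pi_lambda _ N.measurable_HN)

lemma indepFun_config_HL : IndepFun N.config (fun ω i => N.HL i ω) μ := by
  have hle (k : Fin 5) :
    (![MeasurableSpace.comap (fun ω i => N.XL i ω) inferInstance,
      MeasurableSpace.comap (fun ω i => N.XN i ω) inferInstance,
      MeasurableSpace.comap (fun ω i => N.XT i ω) inferInstance,
      MeasurableSpace.comap (fun ω i => N.HL i ω) inferInstance,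
      MeasurableSpace.comap (fun ω i => N.HN i ω) inferInstance] : Fin 5 → MeasurableSpace Ω) k
        ≤ mΩ := by
    fin_cases k
    · exact (measurable_pi_lambda _ N.poissonL.1).comap_le
    · exact (measurable_pi_lambda _ N.poissonN.1).comap_le
    · exact (measurable_pi_lambda _ N.poissonT.1).comap_le
    · exact (measurable_pi_lambda _ N.measurable_HL).comap_le
    · exact (measurable_pi_lambda _ N.measurable_HN).comap_le
  -- Index `3` is the σ-algebra of the LoS gains.
  have h := indep_iSup_of_disjoint hle N.indep (S := {3}ᶜ) (T := {3}) disjoint_compl_left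
  refine indep_of_indep_of_le_left (indep_of_indep_of_le_right h ?_) ?_
  · exact le_iSup₂_of_le 3 rfl le_rfl
  · refine Measurable.comap_le ?_
    refine Measurable.prodMk ?_ (Measurable.prodMk ?_ (Measurable.prodMk ?_ ?_))
    · exact (comap_measurable _).mono (le_iSup₂_of_le 0 (by simp) le_rfl) le_rfl
    · exact (comap_measurable _).mono (le_iSup₂_of_le 1 (by simp) le_rfl) le_rfl
    · exact (comap_measurable _).mono (le_iSup₂_of_le 2 (by simp) le_rfl) le_rfl
    · exact (comap_measurable _).mono (le_iSup₂_of_le 4 (by simp) le_rfl) le_rfl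

/-- The gains of the LoS ABSs other than the `n`-th. -/
def gainsExcept (n : ℕ) (ω : Ω) : ℕ → ℝ := fun i => if i = n then 0 else N.HL i ω

lemma measurable_gainsExcept (n : ℕ) : Measurable (N.gainsExcept n) := by
  refine measurable_pi_lambda _ fun i => ?_
  unfold gainsExcept
  split_ifs
  · exact measurable_const
  · exact N.measurable_HL i

lemma indepFun_gainsExcept_HL (n : ℕ) : IndepFun (N.gainsExcept n) (N.HL n) μ := by
  have h := indep_iSup_of_disjoint (fun i => (N.measurable_HL i).comap_le) N.indep_HL
    (S := {n}ᶜ) (T := {n}) disjoint_compl_left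
  refine indep_of_indep_of_le_left (indep_of_indep_of_le_right h ?_) ?_
  · exact le_iSup₂_of_le n rfl le_rfl
  · refine Measurable.comap_le (@measurable_pi_lambda _ _ _ (_) _ _ fun i => ?_)
    simp only [gainsExcept]
    split_ifs with hi
    · exact measurable_const
    · exact (comap_measurable (N.HL i)).mono (le_iSup₂_of_le i hi le_rfl) le_rfl

variable [IsProbabilityMeasure μ]

/-- The configuration is independent of the whole gain sequence, and within that sequence the `n`-th
gain is independent of the others. -/
lemma indepFun_config_gainsExcept_HL (n : ℕ) :
    IndepFun (fun ω => (N.config ω, N.gainsExcept n ω)) (N.HL n) μ := by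
  refine indepFun_prodMk_of_indepFun_prodMk N.measurable_config (N.measurable_gainsExcept n)
    (N.measurable_HL n) ?_ (N.indepFun_gainsExcept_HL n)
  have hg : Measurable fun x : ℕ → ℝ => ((fun i => if i = n then 0 else x i : ℕ → ℝ), x n) := by
    refine Measurable.prodMk (measurable_pi_lambda _ fun i => ?_) (measurable_pi_apply n)
    split_ifs
    · exact measurable_const
    · exact measurable_pi_apply i
  exact N.indepFun_config_HL.comp measurable_id hg

/-- The gain of the serving ABS is Gamma distributed and independent of the interference, the
association event and the serving distance. -/
lemma measure_inter_HL_nearest {A : Set (ℝ × ℝ≥0∞)} (hA : MeasurableSet A) {C : Set ℝ}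
    (hC : MeasurableSet C) :
    μ ((N.assocL ∩ (fun ω => (N.RL0 ω, N.interfA ω)) ⁻¹' A) ∩
        (fun ω => N.HL (N.nearest ω) ω) ⁻¹' C) =
      μ (N.assocL ∩ (fun ω => (N.RL0 ω, N.interfA ω)) ⁻¹' A) * gammaMeasure p.mL p.mL C := by
  -- The serving index is random, so the event is cut according to its value.
  have hsplit (S : Set Ω) (hS : MeasurableSet S) :
      μ S = ∑' n, μ (S ∩ N.nearest ⁻¹' {n}) := by
    have hU : S = ⋃ n, S ∩ N.nearest ⁻¹' {n} := by
      ext ω; simp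
    conv_lhs => rw [hU]
    refine measure_iUnion (fun i j hij => ?_) fun n =>
      hS.inter (N.measurable_nearest N.poissonL.1 (measurableSet_singleton n))
    refine Set.disjoint_left.2 fun ω h1 h2 => hij ?_
    exact h1.2.symm.trans h2.2
  have hB := N.measurableSet_assocL N.poissonL.1 N.poissonN.1 N.poissonT.1
  have hT : Measurable fun ω => (N.RL0 ω, N.interfA ω) :=
    (N.measurable_RL0 N.poissonL.1).prodMk N.measurable_interfA
  have hS := hB.inter (hT hA)
  rw [hsplit _ (hS.inter (N.measurable_comp_nearest N.measurable_HL hC)), hsplit _ hS,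
    ← ENNReal.tsum_mul_right]
  refine tsum_congr fun n => ?_
  have hcfg : Measurable[MeasurableSpace.comap (fun ω => (N.config ω, N.gainsExcept n ω))
      inferInstance] fun ω => (N.config ω, N.gainsExcept n ω) := comap_measurable _
  have hXL (i : ℕ) : Measurable[MeasurableSpace.comap
      (fun ω => (N.config ω, N.gainsExcept n ω)) inferInstance] (N.XL i) :=
    (measurable_pi_apply i).comp hcfg.fst.fst
  have hXN (i : ℕ) : Measurable[MeasurableSpace.comap
      (fun ω => (N.config ω, N.gainsExcept n ω)) inferInstance] (N.XN i) :=
    (measurable_pi_apply i).comp hcfg.fst.snd.fst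
  have hXT (i : ℕ) : Measurable[MeasurableSpace.comap
      (fun ω => (N.config ω, N.gainsExcept n ω)) inferInstance] (N.XT i) :=
    (measurable_pi_apply i).comp hcfg.fst.snd.snd.fst
  have hHN (i : ℕ) : Measurable[MeasurableSpace.comap
      (fun ω => (N.config ω, N.gainsExcept n ω)) inferInstance] (N.HN i) :=
    (measurable_pi_apply i).comp hcfg.fst.snd.snd.snd
  have hHL (i : ℕ) (hi : i ≠ n) : Measurable[MeasurableSpace.comap
      (fun ω => (N.config ω, N.gainsExcept n ω)) inferInstance] (N.HL i) := by
    have h := (measurable_pi_apply i).comp hcfg.snd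
    have hfun : (fun x : ℕ → ℝ => x i) ∘ (N.gainsExcept n) = N.HL i := by
      funext ω; simp [gainsExcept, hi]
    exact hfun ▸ h
  -- On `{nearest = n}` the interference is `interfExcept n`, so the whole first event is measurable
  -- for `config` and `gainsExcept n`.
  have hind := (Indep_iff _ _ _).1 (N.indepFun_config_gainsExcept_HL n)
    ((N.assocL ∩ (fun ω => (N.RL0 ω, N.interfExcept n ω)) ⁻¹' A) ∩ N.nearest ⁻¹' {n})
    (N.HL n ⁻¹' C)
    (((N.measurableSet_assocL hXL hXN hXT).inter
      (((N.measurable_RL0 hXL).prodMk (N.measurable_interfExcept hXL hXN hHN n hHL)) hA)).inter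
      (N.measurable_nearest hXL (measurableSet_singleton n))) ⟨C, hC, rfl⟩
  rw [← N.law_HL n, Measure.map_apply (N.measurable_HL n) hC]
  convert hind using 2
  · ext ω
    simp only [Set.mem_inter_iff, Set.mem_preimage, Set.mem_singleton_iff,
      interfA_eq_interfExcept]
    constructor
    · rintro ⟨⟨⟨h1, h2⟩, h3⟩, rfl⟩
      exact ⟨⟨⟨h1, h2⟩, rfl⟩, h3⟩
    · rintro ⟨⟨⟨h1, h2⟩, rfl⟩, h3⟩
      exact ⟨⟨⟨h1, h2⟩, h3⟩, rfl⟩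
  · congr 1
    ext ω
    simp only [Set.mem_inter_iff, Set.mem_preimage, Set.mem_singleton_iff,
      interfA_eq_interfExcept]
    constructor <;>
    · rintro ⟨⟨h1, h2⟩, rfl⟩
      exact ⟨⟨h1, h2⟩, rfl⟩

end Network

/-! ### Disintegration along the serving distance. -/

/-- Conditional law of `ψ (X, Y, H)` given `X` when `H` has law `ρ` and is independent of
`(X, Y)`. -/
lemma condDistrib_of_map_eq_prod {Ω S T H E : Type*} [MeasurableSpace Ω] [MeasurableSpace S]
    [MeasurableSpace T] [StandardBorelSpace T] [Nonempty T] [MeasurableSpace H]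
    [MeasurableSpace E] [StandardBorelSpace E] [Nonempty E] {ν : Measure Ω} [IsFiniteMeasure ν]
    {ρ : Measure H} [IsProbabilityMeasure ρ] {X : Ω → S} {Y : Ω → T} {Z : Ω → H}
    (hX : Measurable X) (hY : Measurable Y) (hZ : Measurable Z)
    (h : ν.map (fun ω => ((X ω, Y ω), Z ω)) = (ν.map fun ω => (X ω, Y ω)).prod ρ)
    {ψ : (S × T) × H → E} (hψ : Measurable ψ) {U : Set E} (hU : MeasurableSet U) :
    ∀ᵐ x ∂(ν.map X), condDistrib (fun ω => ψ ((X ω, Y ω), Z ω)) X ν x U =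
      ∫⁻ y, ρ {z | ψ ((x, y), z) ∈ U} ∂(condDistrib Y X ν x) := by
  have hW : Measurable fun ω => ψ ((X ω, Y ω), Z ω) := hψ.comp ((hX.prodMk hY).prodMk hZ)
  have hg : Measurable fun q : S × T => ρ {z | ψ (q, z) ∈ U} :=
    measurable_measure_prodMk_left (hψ hU)
  -- Integrated over any measurable `A`, both sides give the mass of `{X ∈ A, ψ ∈ U}`.
  refine ae_eq_of_forall_setLIntegral_eq_of_sigmaFinite (Kernel.measurable_coe _ hU)
    (Measurable.lintegral_kernel_prod_right hg) fun A hA _ => ?_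
  have hAU : MeasurableSet {q : (S × T) × H | q.1.1 ∈ A ∧ ψ q ∈ U} :=
    (measurable_fst.fst hA).inter (hψ hU)
  calc ∫⁻ x in A, condDistrib (fun ω => ψ ((X ω, Y ω), Z ω)) X ν x U ∂(ν.map X)
      = ν.map (fun ω => ((X ω, Y ω), Z ω)) {q | q.1.1 ∈ A ∧ ψ q ∈ U} := by
        rw [← Measure.compProd_apply_prod hA hU, compProd_map_condDistrib hW.aemeasurable,
          Measure.map_apply (hX.prodMk hW) (hA.prod hU),
          Measure.map_apply ((hX.prodMk hY).prodMk hZ) hAU]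
        rfl
    _ = ∫⁻ q in A ×ˢ Set.univ, ρ {z | ψ (q, z) ∈ U} ∂(ν.map fun ω => (X ω, Y ω)) := by
        rw [h, Measure.prod_apply hAU, ← lintegral_indicator (hA.prod MeasurableSet.univ)]
        refine lintegral_congr fun q => ?_
        by_cases hq : q.1 ∈ A
        · rw [Set.indicator_of_mem (Set.mem_prod.2 ⟨hq, Set.mem_univ _⟩)]
          congr 1
          ext z
          simp [hq]
        · rw [Set.indicator_of_notMem fun hq' => hq hq'.1]
          simp [hq]
    _ = _ := by
        rw [← compProd_map_condDistrib hY.aemeasurable,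
          Measure.setLIntegral_compProd hg hA MeasurableSet.univ]
        simp

/-! ### Coverage as a threshold condition on the serving gain. -/

namespace Params

variable (p : Params)

/-- SINR of the far user as a function of the serving distance, the interference and the gain of
the serving ABS. -/
def sinrOf (q : (ℝ × ℝ≥0∞) × ℝ) : ℝ≥0∞ :=
  ENNReal.ofReal (p.am * (p.PA * p.CL * q.1.1 ^ (-p.alphaL) * q.2)) /
    (ENNReal.ofReal (p.an * (p.PA * p.CL * q.1.1 ^ (-p.alphaL) * q.2)) + q.1.2 +
      ENNReal.ofReal p.sigma2)

lemma measurable_sinrOf : Measurable p.sinrOf := by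
  unfold sinrOf
  fun_prop

/-- Gain of the serving ABS beyond which a far user at distance `r` is covered against
interference `y`. -/
def gainThreshold (eps r y : ℝ) : ℝ :=
  p.epsFar eps * r ^ p.alphaL * (y + p.sigma2) / (p.PA * p.CL)

variable {p}

lemma am_pos : 0 < p.am := p.an_pos.trans p.an_lt_am

lemma sinrOf_top (r z : ℝ) : p.sinrOf ((r, ∞), z) = 0 := by
  simp [sinrOf]

/-- Clearing the denominator moves the intra-pair interference to the signal side, whence the
coefficient `a_m - a_n ε_t`. A negative gain is truncated by `ENNReal.ofReal` and gives SINR `0`,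
hence the clause `0 ≤ z`. -/
lemma lt_sinrOf_iff {eps r z : ℝ} {y : ℝ≥0∞} (heps : 0 < eps) (hr : 0 < r) (hy : y ≠ ∞) :
    ENNReal.ofReal eps < p.sinrOf ((r, y), z) ↔ 0 ≤ z ∧
      eps * (y.toReal + p.sigma2) <
        (p.am - p.an * eps) * (p.PA * p.CL * r ^ (-p.alphaL) * z) := by
  have hy0 : 0 ≤ y.toReal := ENNReal.toReal_nonneg
  have hs := p.sigma2_pos
  have hc : 0 < p.PA * p.CL * r ^ (-p.alphaL) :=
    mul_pos (mul_pos p.PA_pos p.CL_pos) (Real.rpow_pos_of_pos hr _)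
  have ham := p.am_pos
  have han := p.an_pos
  simp only [sinrOf]
  rcases lt_or_ge z 0 with h | h
  · have h1 : p.am * (p.PA * p.CL * r ^ (-p.alphaL) * z) ≤ 0 :=
      mul_nonpos_of_nonneg_of_nonpos ham.le (mul_nonpos_of_nonneg_of_nonpos hc.le h.le)
    rw [ENNReal.ofReal_of_nonpos h1, ENNReal.zero_div]
    simp [h]
  · have h1 : 0 ≤ p.an * (p.PA * p.CL * r ^ (-p.alphaL) * z) := by positivity
    rw [← ENNReal.ofReal_toReal hy, ← ENNReal.ofReal_add h1 hy0,
      ← ENNReal.ofReal_add (by positivity) hs.le, ← ENNReal.ofReal_div_of_pos (by positivity),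
      ENNReal.ofReal_lt_ofReal_iff_of_nonneg heps.le, lt_div_iff₀ (by positivity),
      ENNReal.toReal_ofReal hy0, and_iff_right h]
    constructor <;> intro <;> linarith

lemma sinrOf_le {eps r z : ℝ} {y : ℝ≥0∞} (heps : 0 < eps) (hr : 0 < r)
    (hle : p.am - p.an * eps ≤ 0) : p.sinrOf ((r, y), z) ≤ ENNReal.ofReal eps := by
  rcases eq_or_ne y ∞ with rfl | hy
  · simp [sinrOf_top]
  · refine not_lt.1 fun hlt => ?_
    obtain ⟨hz, h⟩ := (lt_sinrOf_iff heps hr hy).1 hlt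
    have h1 : 0 ≤ p.PA * p.CL * r ^ (-p.alphaL) * z :=
      mul_nonneg (mul_pos (mul_pos p.PA_pos p.CL_pos) (Real.rpow_pos_of_pos hr _)).le hz
    have h2 : 0 < eps * (y.toReal + p.sigma2) :=
      mul_pos heps (add_pos_of_nonneg_of_pos ENNReal.toReal_nonneg p.sigma2_pos)
    have h3 := mul_nonpos_of_nonpos_of_nonneg hle h1
    linarith

lemma gainThreshold_nonneg {eps r y : ℝ} (heps : 0 < eps) (hr : 0 < r)
    (hpos : 0 < p.am - p.an * eps) (hy : 0 ≤ y) : 0 ≤ p.gainThreshold eps r y := by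
  have := p.sigma2_pos
  have := p.PA_pos
  have := p.CL_pos
  unfold gainThreshold epsFar
  positivity

lemma lt_sinrOf_iff_gainThreshold_lt {eps r z : ℝ} {y : ℝ≥0∞} (heps : 0 < eps) (hr : 0 < r)
    (hpos : 0 < p.am - p.an * eps) (hy : y ≠ ∞) :
    ENNReal.ofReal eps < p.sinrOf ((r, y), z) ↔ p.gainThreshold eps r y.toReal < z := by
  have hc : 0 < p.PA * p.CL := mul_pos p.PA_pos p.CL_pos
  have hrα : 0 < r ^ p.alphaL := Real.rpow_pos_of_pos hr _
  have hkey : eps * (y.toReal + p.sigma2) <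
        (p.am - p.an * eps) * (p.PA * p.CL * r ^ (-p.alphaL) * z) ↔
      p.gainThreshold eps r y.toReal < z := by
    have h1 : (p.am - p.an * eps) * (p.PA * p.CL * r ^ (-p.alphaL) * z) =
        (p.am - p.an * eps) * (p.PA * p.CL) / r ^ p.alphaL * z := by
      rw [Real.rpow_neg hr.le]
      ring
    have h2 : p.gainThreshold eps r y.toReal =
        eps * (y.toReal + p.sigma2) / ((p.am - p.an * eps) * (p.PA * p.CL) / r ^ p.alphaL) := by
      unfold gainThreshold epsFar
      field_simp
    rw [h1, h2, div_lt_iff₀' (by positivity)]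
  -- The clause `0 ≤ z` is automatic above a nonnegative threshold.
  rw [lt_sinrOf_iff heps hr hy, hkey, and_iff_right_iff_imp]
  exact fun h => (gainThreshold_nonneg heps hr hpos ENNReal.toReal_nonneg).trans h.le

variable (p) in
/-- Probability of coverage of a far user at distance `r` against interference `y`. -/
def coverGiven (eps r : ℝ) (y : ℝ≥0∞) : ℝ :=
  (gammaMeasure p.mL p.mL).real {z | ENNReal.ofReal eps < p.sinrOf ((r, y), z)}

lemma measurable_coverGiven (eps r : ℝ) : Measurable (p.coverGiven eps r) := by
  have hm : (0 : ℝ) < p.mL := Nat.cast_pos.2 p.mL_pos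
  have := isProbabilityMeasure_gammaMeasure hm hm
  have h := measurable_measure_prodMk_left (ν := gammaMeasure p.mL p.mL)
    (p.measurable_sinrOf (measurableSet_Ioi (a := ENNReal.ofReal eps)))
  exact (h.comp measurable_prodMk_left).ennreal_toReal

lemma coverGiven_top (eps r : ℝ) : p.coverGiven eps r ∞ = 0 := by
  simp [coverGiven, sinrOf_top]

lemma coverGiven_of_ne_top {eps r : ℝ} {y : ℝ≥0∞} (heps : 0 < eps) (hr : 0 < r)
    (hpos : 0 < p.am - p.an * eps) (hy : y ≠ ∞) :
    p.coverGiven eps r y =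
      1 - (gammaMeasure p.mL p.mL).real (Set.Iic (p.gainThreshold eps r y.toReal)) := by
  have hm : (0 : ℝ) < p.mL := Nat.cast_pos.2 p.mL_pos
  have := isProbabilityMeasure_gammaMeasure hm hm
  rw [← probReal_compl_eq_one_sub measurableSet_Iic, Set.compl_Iic, coverGiven]
  congr 1
  ext z
  exact lt_sinrOf_iff_gainThreshold_lt heps hr hpos hy

lemma coverGiven_eq_zero {eps r : ℝ} (heps : 0 < eps) (hr : 0 < r)
    (hle : p.am - p.an * eps ≤ 0) (y : ℝ≥0∞) : p.coverGiven eps r y = 0 := by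
  simp [coverGiven, (sinrOf_le heps hr hle).not_gt]

variable (p) in
/-- The approximation of `coverGiven` in which the Gamma distribution function is replaced by
`(1 - exp (-c τ)) ^ m`. -/
def coverApprox (c eps r : ℝ) (y : ℝ≥0∞) : ℝ :=
  if y = ∞ then 0 else 1 - (1 - Real.exp (-(c * p.gainThreshold eps r y.toReal))) ^ p.mL

lemma coverGiven_le_coverApprox {eps r : ℝ} (heps : 0 < eps) (hr : 0 < r)
    (hpos : 0 < p.am - p.an * eps) (y : ℝ≥0∞) :
    p.coverGiven eps r y ≤ p.coverApprox (alzerRate p.mL) eps r y := by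
  rcases eq_or_ne y ∞ with rfl | hy
  · simp [coverGiven_top, coverApprox]
  · rw [coverGiven_of_ne_top heps hr hpos hy, coverApprox, if_neg hy]
    exact sub_le_sub_left (le_gammaMeasure_real_Iic p.mL_pos
      (gainThreshold_nonneg heps hr hpos ENNReal.toReal_nonneg)) 1

lemma coverApprox_le_coverGiven {eps r : ℝ} (heps : 0 < eps) (hr : 0 < r)
    (hpos : 0 < p.am - p.an * eps) (y : ℝ≥0∞) :
    p.coverApprox p.mL eps r y ≤ p.coverGiven eps r y := by
  rcases eq_or_ne y ∞ with rfl | hy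
  · simp [coverGiven_top, coverApprox]
  · rw [coverGiven_of_ne_top heps hr hpos hy, coverApprox, if_neg hy]
    exact sub_le_sub_left (gammaMeasure_real_Iic_le p.mL_pos
      (gainThreshold_nonneg heps hr hpos ENNReal.toReal_nonneg)) 1

lemma abs_coverGiven_sub_coverApprox_le {eps r : ℝ} (heps : 0 < eps) (hr : 0 < r)
    (hpos : 0 < p.am - p.an * eps) (y : ℝ≥0∞) :
    |p.coverGiven eps r y - p.coverApprox (alzerRate p.mL) eps r y| ≤ alzerGap p.mL := by
  rcases eq_or_ne y ∞ with rfl | hy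
  · simp [coverGiven_top, coverApprox, alzerGap_nonneg p.mL_pos]
  · rw [coverGiven_of_ne_top heps hr hpos hy, coverApprox, if_neg hy, sub_sub_sub_cancel_left,
      abs_sub_comm]
    exact abs_sub_le_alzerGap p.mL_pos
      (gainThreshold_nonneg heps hr hpos ENNReal.toReal_nonneg)

end Params

/-! ### Binomial expansion and averaging over the interference. -/

/-- The function `1 - (1 - exp (-t)) ^ m` expanded by the binomial theorem. -/
lemma one_sub_one_sub_exp_pow (m : ℕ) (t : ℝ) :
    1 - (1 - Real.exp (-t)) ^ m =
      ∑ k ∈ Finset.Icc 1 m, (-1 : ℝ) ^ (k + 1) * (m.choose k : ℝ) * Real.exp (-(k * t)) := by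
  have h : (1 - Real.exp (-t)) ^ m =
      ∑ k ∈ Finset.range (m + 1), (-1 : ℝ) ^ k * (m.choose k : ℝ) * Real.exp (-(k * t)) := by
    rw [sub_eq_neg_add, add_pow]
    refine Finset.sum_congr rfl fun k _ => ?_
    rw [neg_pow, ← Real.exp_nat_mul, one_pow, mul_neg]
    ring
  have hIcc : Finset.Icc 1 m = Finset.Ico (0 + 1) (m + 1) := by
    ext k; simp
  rw [h, Finset.sum_range_succ', hIcc, ← Finset.sum_Ico_add', ← Finset.range_eq_Ico]
  simp only [pow_succ]
  simp

namespace Network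

variable {p : Params} {Ω : Type*} [MeasurableSpace Ω] {μ : Measure Ω} (N : Network p μ)

lemma measurable_expNeg (s : ℝ) : Measurable (expNeg s) :=
  Measurable.ite (measurableSet_singleton ∞) measurable_const
    ((ENNReal.measurable_toReal.const_mul s).neg.exp)

lemma expNeg_nonneg (s : ℝ) (y : ℝ≥0∞) : 0 ≤ expNeg s y := by
  unfold expNeg
  split_ifs <;> positivity

lemma expNeg_le_one {s : ℝ} (hs : 0 ≤ s) (y : ℝ≥0∞) : expNeg s y ≤ 1 := by
  unfold expNeg
  split_ifs
  · exact zero_le_one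
  · exact Real.exp_le_one_iff.2 (neg_nonpos.2 (mul_nonneg hs ENNReal.toReal_nonneg))

lemma integrable_expNeg {s : ℝ} (hs : 0 ≤ s) (κ : Measure ℝ≥0∞) [IsFiniteMeasure κ] :
    Integrable (expNeg s) κ :=
  Integrable.of_bound (measurable_expNeg s).aestronglyMeasurable 1 <| ae_of_all _ fun y => by
    rw [Real.norm_of_nonneg (expNeg_nonneg s y)]
    exact expNeg_le_one hs y

lemma sinrFarL_eq_sinrOf (ω : Ω) :
    N.sinrFarL ω = p.sinrOf ((N.RL0 ω, N.interfA ω), N.HL (N.nearest ω) ω) := by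
  simp only [sinrFarL, Params.sinrOf, signalL, interfA, add_assoc]

variable [IsProbabilityMeasure μ]

/-- Conditioning on association rescales both sides of `measure_inter_HL_nearest` by the same
constant; rectangles determine the product measure. -/
lemma map_cond_assocL_eq_prod :
    (μ[|N.assocL]).map (fun ω => ((N.RL0 ω, N.interfA ω), N.HL (N.nearest ω) ω)) =
      ((μ[|N.assocL]).map fun ω => (N.RL0 ω, N.interfA ω)).prod (gammaMeasure p.mL p.mL) := by
  have hm : (0 : ℝ) < p.mL := Nat.cast_pos.2 p.mL_pos
  have := isProbabilityMeasure_gammaMeasure hm hm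
  have hB := N.measurableSet_assocL N.poissonL.1 N.poissonN.1 N.poissonT.1
  have hT : Measurable fun ω => (N.RL0 ω, N.interfA ω) :=
    (N.measurable_RL0 N.poissonL.1).prodMk N.measurable_interfA
  have hH : Measurable fun ω => N.HL (N.nearest ω) ω :=
    N.measurable_comp_nearest N.measurable_HL
  refine (Measure.prod_eq fun A C hA hC => ?_).symm
  rw [Measure.map_apply (hT.prodMk hH) (hA.prod hC), Measure.map_apply hT hA,
    cond_apply hB, cond_apply hB, mul_assoc, ← N.measure_inter_HL_nearest hA hC,
    Set.inter_assoc]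
  rfl

/-- The only almost-everywhere step; the later comparisons hold for each `r > 0`. -/
lemma covFarL_ae_eq (eps : ℝ) :
    ∀ᵐ r ∂((μ[|N.assocL]).map N.RL0), N.covFarL eps r =
      ∫ y, p.coverGiven eps r y ∂(condDistrib N.interfA N.RL0 μ[|N.assocL] r) := by
  have hm : (0 : ℝ) < p.mL := Nat.cast_pos.2 p.mL_pos
  have := isProbabilityMeasure_gammaMeasure hm hm
  filter_upwards [condDistrib_of_map_eq_prod (N.measurable_RL0 N.poissonL.1)
    N.measurable_interfA (N.measurable_comp_nearest N.measurable_HL) N.map_cond_assocL_eq_prod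
    p.measurable_sinrOf (measurableSet_Ioi (a := ENNReal.ofReal eps))] with r hr
  rw [covFarL, show N.sinrFarL = fun ω => p.sinrOf ((N.RL0 ω, N.interfA ω),
    N.HL (N.nearest ω) ω) from funext N.sinrFarL_eq_sinrOf, measureReal_def, hr]
  have h := measurable_measure_prodMk_left (ν := gammaMeasure p.mL p.mL)
    (p.measurable_sinrOf (measurableSet_Ioi (a := ENNReal.ofReal eps)))
  exact (integral_toReal (h.comp measurable_prodMk_left).aemeasurable
    (ae_of_all _ fun y => measure_lt_top _ _)).symm

lemma integrable_coverGiven (eps r : ℝ) (κ : Measure ℝ≥0∞) [IsFiniteMeasure κ] :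
    Integrable (p.coverGiven eps r) κ := by
  have hm : (0 : ℝ) < p.mL := Nat.cast_pos.2 p.mL_pos
  have := isProbabilityMeasure_gammaMeasure hm hm
  refine Integrable.of_bound (Params.measurable_coverGiven eps r).aestronglyMeasurable 1 <|
    ae_of_all _ fun y => ?_
  rw [Params.coverGiven, Real.norm_of_nonneg measureReal_nonneg]
  exact measureReal_le_one

/-- The threshold is affine in `y`, so each exponential splits into a noise factor and a Laplace
kernel; at `y = ∞` both sides vanish. -/
lemma coverApprox_eq_sum (c eps r : ℝ) (y : ℝ≥0∞) :
    p.coverApprox c eps r y =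
      ∑ k ∈ Finset.Icc 1 p.mL, (-1 : ℝ) ^ (k + 1) * (p.mL.choose k : ℝ) *
        Real.exp (-((k : ℝ) * c *
          (p.epsFar eps * r ^ p.alphaL * p.sigma2 / (p.PA * p.CL)))) *
        expNeg ((k : ℝ) * c * (p.epsFar eps * r ^ p.alphaL / (p.PA * p.CL))) y := by
  rcases eq_or_ne y ∞ with rfl | hy
  · simp [Params.coverApprox, expNeg]
  · rw [Params.coverApprox, if_neg hy, one_sub_one_sub_exp_pow]
    refine Finset.sum_congr rfl fun k _ => ?_
    rw [expNeg, if_neg hy, mul_assoc _ (Real.exp _) (Real.exp _), ← Real.exp_add]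
    congr 2
    unfold Params.gainThreshold
    ring

lemma integrable_coverApprox_term {c eps r : ℝ} (hc : 0 ≤ c) (heps : 0 < eps) (hr : 0 < r)
    (hpos : 0 < p.am - p.an * eps) (κ : Measure ℝ≥0∞) [IsFiniteMeasure κ] (w : ℝ) (k : ℕ) :
    Integrable (fun y => w *
      expNeg ((k : ℝ) * c * (p.epsFar eps * r ^ p.alphaL / (p.PA * p.CL))) y) κ := by
  have := p.PA_pos
  have := p.CL_pos
  refine (integrable_expNeg ?_ κ).const_mul w
  unfold Params.epsFar
  positivity

lemma integrable_coverApprox {c eps r : ℝ} (hc : 0 ≤ c) (heps : 0 < eps) (hr : 0 < r)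
    (hpos : 0 < p.am - p.an * eps) (κ : Measure ℝ≥0∞) [IsFiniteMeasure κ] :
    Integrable (p.coverApprox c eps r) κ := by
  rw [funext (coverApprox_eq_sum c eps r)]
  exact integrable_finsetSum _ fun k _ => integrable_coverApprox_term hc heps hr hpos κ _ k

lemma farSum_eq_integral {c eps r : ℝ} (hc : 0 ≤ c) (heps : 0 < eps) (hr : 0 < r)
    (hpos : 0 < p.am - p.an * eps) :
    N.farSum c eps r =
      ∫ y, p.coverApprox c eps r y ∂(condDistrib N.interfA N.RL0 μ[|N.assocL] r) := by
  simp_rw [coverApprox_eq_sum]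
  rw [integral_finsetSum _ fun k _ => integrable_coverApprox_term hc heps hr hpos _ _ k]
  simp_rw [integral_const_mul]
  rfl

end Network

end UAVNoma

end

/-! ### The proposition. -/

theorem mainTheorem8 {Ω : Type*} [MeasurableSpace Ω] (μ : MeasureTheory.Measure Ω)
    [MeasureTheory.IsProbabilityMeasure μ] (p : UAVNoma.Params) (N : UAVNoma.Network p μ)
    (eps : ℝ) (heps : 0 < eps) :
    (0 < p.am - p.an * eps →
      ∀ᵐ r ∂((ProbabilityTheory.cond μ N.assocL).map N.RL0), p.Rf < r →
        N.farSum (p.mL : ℝ) eps r ≤ N.covFarL eps r ∧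
        N.covFarL eps r ≤ N.farSum (UAVNoma.alzerRate p.mL) eps r ∧
        |N.covFarL eps r - N.farSum (UAVNoma.alzerRate p.mL) eps r| ≤ UAVNoma.alzerGap p.mL ∧
        (p.mL = 1 → N.covFarL eps r = N.farSum (UAVNoma.alzerRate p.mL) eps r)) ∧
    (p.am - p.an * eps ≤ 0 →
      ∀ᵐ r ∂((ProbabilityTheory.cond μ N.assocL).map N.RL0), p.Rf < r →
        N.covFarL eps r = 0) := by
  have hRf : 0 < p.Rf := p.h_pos.trans_le p.h_le_Rf
  constructor
  · intro hpos
    filter_upwards [N.covFarL_ae_eq eps] with r hcov hr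
    have hr0 : 0 < r := hRf.trans hr
    have hQ := UAVNoma.Network.integrable_coverGiven (p := p) eps r
      (condDistrib N.interfA N.RL0 μ[|N.assocL] r)
    have hm : (0 : ℝ) ≤ p.mL := Nat.cast_nonneg _
    have hb := (UAVNoma.alzerRate_pos p.mL_pos).le
    have hlow : N.farSum (p.mL : ℝ) eps r ≤ N.covFarL eps r := by
      rw [hcov, N.farSum_eq_integral hm heps hr0 hpos]
      exact integral_mono (UAVNoma.Network.integrable_coverApprox hm heps hr0 hpos _) hQ
        (UAVNoma.Params.coverApprox_le_coverGiven heps hr0 hpos)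
    have hup : N.covFarL eps r ≤ N.farSum (UAVNoma.alzerRate p.mL) eps r := by
      rw [hcov, N.farSum_eq_integral hb heps hr0 hpos]
      exact integral_mono hQ (UAVNoma.Network.integrable_coverApprox hb heps hr0 hpos _)
        (UAVNoma.Params.coverGiven_le_coverApprox heps hr0 hpos)
    refine ⟨hlow, hup, ?_, fun h1 => le_antisymm hup ?_⟩
    · rw [hcov, N.farSum_eq_integral hb heps hr0 hpos,
        ← integral_sub hQ (UAVNoma.Network.integrable_coverApprox hb heps hr0 hpos _)]
      have h := norm_integral_le_of_norm_le_const
        (μ := condDistrib N.interfA N.RL0 μ[|N.assocL] r)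
        (f := fun y => p.coverGiven eps r y - p.coverApprox (UAVNoma.alzerRate p.mL) eps r y)
        (C := UAVNoma.alzerGap p.mL)
        (ae_of_all _ (UAVNoma.Params.abs_coverGiven_sub_coverApprox_le heps hr0 hpos))
      simpa using h
    -- For shape `1` the two rates agree, so the lower and upper bounds coincide.
    · have h : UAVNoma.alzerRate p.mL = p.mL := by simp [UAVNoma.alzerRate, h1]
      rw [h]
      exact hlow
  · intro hle
    filter_upwards [N.covFarL_ae_eq eps] with r hcov hr
    rw [hcov]
    simp [UAVNoma.Params.coverGiven_eq_zero heps (hRf.trans hr) hle]
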